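/- Let $E$ be a Dedekind complete real $\Phi$-algebra, that is, a Dedekind complete real vector lattice that is also an associative algebra with multiplicative unit such that products of positive elements are positive and $x\wedge y=0$, $z\ge 0$ imply $(xz)\wedge y=(zx)\wedge y=0$. An element $r\ge 0$ of $E$ is a weak order unit if the band generated by $r$ is $E$; write $x\ll y$ if $y-x$ is a weak order unit. For $a,b,c,r\in E$ with $r\gg 0$ put $[a,b]=\{x: a\le x\le b\}$, $(a,b)=\{x: a\ll x\ll b\}$ and $N(c,r)=\{z: |z-c|\ll r\}$. A net $(x_\alpha)$ in $E$ converges in order to $x$ if there is a set $\mathcal E\subseteq E$ with $\inf\mathcal E=0$ such that for every $\varepsilon\in\mathcal E$ there is $\alpha_0$ with $|x_\alpha-x|\le\varepsilon$ for all $\alpha\ge\alpha_0$. A function $f\colon D\to E$, $D\subseteq E$, is order continuous if for every $c\in D$ and every net $(x_\alpha)$ in $D$ converging in order to $c$, the net $(f(x_\alpha))$ converges in order to $f(c)$. It is super order differentiable at $c\in D$ with derivative $f'(c)\in E$ if there is $r\gg 0$ with $N(c,r)\subseteq D$ and, for every nonempty downwards directed set $\Delta\subseteq E$ with $\inf\Delta=0$,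 there is a set $\mathcal E\subseteq E$ with $\inf\mathcal E=0$ such that for every $\varepsilon\in\mathcal E$ there is $\delta\in\Delta$ with \[ z\in D \text{ and } |z-c|\le\delta \implies |f(z)-f(c)-(z-c)f'(c)|\le |z-c|\,\varepsilon . \] Rolle's Theorem. Let $a,b\in E$ with $a\ll b$, and let $f\colon[a,b]\to E$ be order continuous on $[a,b]$ and super order differentiable at every point of $(a,b)$ (as a function with domain $D=[a,b]$). If $f(a)=f(b)$, then there exists $x_0\in(a,b)$ with $f'(x_0)=0$. -/

import Mathlib

namespace PhiAlg

universe u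

/-- A real `Φ`-algebra: a real vector lattice that is an associative unital `f`-algebra. The lattice
order is compatible with the linear structure, products of positive elements are positive, and
multiplication by a positive element on either side preserves disjointness.
Commutativity is not assumed. -/
class IsPhiAlgebra (E : Type*) [Ring E] [Lattice E] [Algebra ℝ E] : Prop extends
    IsOrderedAddMonoid E, IsOrderedModule ℝ E where
  mul_nonneg' : ∀ x y : E, 0 ≤ x → 0 ≤ y → 0 ≤ x * y
  mul_inf_eq_zero : ∀ x y z : E, x ⊓ y = 0 → 0 ≤ z → (x * z) ⊓ y = 0
  mul_inf_eq_zero' : ∀ x y z : E, x ⊓ y = 0 → 0 ≤ z → (z * x) ⊓ y = 0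

section Lattice

variable {E : Type u} [Ring E] [Lattice E] [Algebra ℝ E]

/-- A band of a vector lattice: a solid linear subspace that contains the supremum of each of its
subsets whose supremum exists in `E`. -/
structure IsBand (B : Submodule ℝ E) : Prop where
  solid : ∀ x ∈ B, ∀ y : E, |y| ≤ |x| → y ∈ B
  sup_mem : ∀ S : Set E, S ⊆ B → ∀ x : E, IsLUB S x → x ∈ B

/-- The band generated by `x`: the intersection of all bands that contain `x`. -/
def bandGenerated (x : E) : Submodule ℝ E :=
  sInf {B : Submodule ℝ E | IsBand B ∧ x ∈ B}

/-- A weak order unit: a positive element that generates `E` as a band. -/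
def IsWeakOrderUnit (r : E) : Prop :=
  0 ≤ r ∧ bandGenerated r = ⊤

/-- The relation `x ≪ y`: the difference `y - x` is a weak order unit. -/
def LL (x y : E) : Prop :=
  IsWeakOrderUnit (y - x)

/-- The interval `(a, b) = {x | a ≪ x ≪ b}`. -/
def openInterval (a b : E) : Set E :=
  {x | LL a x ∧ LL x b}

/-- The neighbourhood `N(c, r) = {z | |z - c| ≪ r}`. -/
def nbhd (c r : E) : Set E :=
  {z | LL |z - c| r}

/-- Order convergence of a net `u` to `x`. -/
def OrderConverges {ι : Type*} [Preorder ι] (u : ι → E) (x : E) : Prop :=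
  ∃ S : Set E, IsGLB S 0 ∧ ∀ ε ∈ S, ∃ i₀ : ι, ∀ i ≥ i₀, |u i - x| ≤ ε

/-- Order continuity on `D` of a function with domain `D`: for every net in `D` that converges in
order to a point of `D`, the values converge in order to the value at that point. -/
def OrderContinuousOn (f : E → E) (D : Set E) : Prop :=
  ∀ c ∈ D, ∀ (ι : Type u) [Preorder ι] [Nonempty ι] [IsDirectedOrder ι] (x : ι → E),
    (∀ i, x i ∈ D) → OrderConverges x c → OrderConverges (fun i => f (x i)) (f c)

/-- The function `f` with domain `D` is super order differentiable at `c` with derivative `d`. The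
estimate is required for all `z` in the domain near `c`, not only for those in `nbhd c r`. -/
def HasSuperOrderDerivAt (f : E → E) (D : Set E) (c d : E) : Prop :=
  c ∈ D ∧ ∃ r : E, IsWeakOrderUnit r ∧ nbhd c r ⊆ D ∧
    ∀ Δ : Set E, Δ.Nonempty → DirectedOn (· ≥ ·) Δ → IsGLB Δ 0 →
      ∃ S : Set E, IsGLB S 0 ∧ ∀ ε ∈ S, ∃ δ ∈ Δ, ∀ z ∈ D, |z - c| ≤ δ →
        |f z - f c - (z - c) * d| ≤ |z - c| * ε

end Lattice

end PhiAlg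

namespace PhiAlg

universe u

/-! ### Disjointness, squares and the ordered ring structure -/

section Basic

variable {E : Type u} [Ring E] [Lattice E] [Algebra ℝ E] [IsPhiAlgebra E]

/-! No extremum is sought; the proof shrinks horizontal chords to a point. Idempotents act as
components of `E`: they are central, and Dedekind completeness gives every positive element a
support idempotent, so real case distinctions become splittings along idempotents (`exists_sign`).

Differentiability makes `f` local (`isLocalOn_Icc`): each component of a value depends only on that
component of the argument. Solutions found on complementary components can therefore be glued, which
gives an intermediate value theorem (`exists_zero_of_nonpos_of_nonneg`). Applied to `f (x + l) - f
x`, it finds inside any horizontal chord another one of half the length (`exists_half_chord`).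

A first chord is chosen away from `a` and `b` (`exists_inner_chord`). Repeated halving then produces
nested chords around a point `c` of the open interval, and comparing the two ends of each chord with
the linear approximation at `c` forces the derivative there to vanish
(`HasSuperOrderDerivAt.eq_zero`). -/

theorem mul_eq_zero_of_inf_eq_zero {x y : E} (h : x ⊓ y = 0) : x * y = 0 := by
  have hx : 0 ≤ x := h ▸ inf_le_left
  have hy : 0 ≤ y := h ▸ inf_le_right
  have h1 := IsPhiAlgebra.mul_inf_eq_zero x y y h hy
  rw [inf_comm] at h1
  -- Both entries have become `x * y`, which is thus disjoint from itself.
  simpa using IsPhiAlgebra.mul_inf_eq_zero' y (x * y) x h1 hx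

theorem mul_self_nonneg_of_phiAlgebra (x : E) : 0 ≤ x * x := by
  have h := posPart_inf_negPart_eq_zero x
  have h1 := mul_eq_zero_of_inf_eq_zero h
  have h2 := mul_eq_zero_of_inf_eq_zero ((inf_comm _ _).trans h)
  have h3 : x * x = x⁺ * x⁺ + x⁻ * x⁻ := by
    conv_lhs => rw [← posPart_sub_negPart x]
    rw [sub_mul, mul_sub, mul_sub, h1, h2]
    abel
  rw [h3]
  exact add_nonneg (IsPhiAlgebra.mul_nonneg' _ _ (posPart_nonneg x) (posPart_nonneg x))
    (IsPhiAlgebra.mul_nonneg' _ _ (negPart_nonneg x) (negPart_nonneg x))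

instance : ZeroLEOneClass E := ⟨by simpa using mul_self_nonneg_of_phiAlgebra (1 : E)⟩

instance : IsOrderedRing E := IsOrderedRing.of_mul_nonneg IsPhiAlgebra.mul_nonneg'

end Basic

/-! ### Idempotents as components -/

namespace Idem

theorem mul_mix {E : Type u} [Ring E] {e : E} (he : IsIdempotentElem e) (x y : E) :
    e * (e * x + (1 - e) * y) = e * x := by
  rw [mul_add, ← mul_assoc, ← mul_assoc, he.eq, he.mul_one_sub_self, zero_mul, add_zero]

theorem compl_mul_mix {E : Type u} [Ring E] {e : E} (he : IsIdempotentElem e) (x y : E) :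
    (1 - e) * (e * x + (1 - e) * y) = (1 - e) * y := by
  rw [mul_add, ← mul_assoc, ← mul_assoc, he.one_sub.eq, he.one_sub_mul_self, zero_mul, zero_add]

theorem eq_of_split {E : Type u} [Ring E] {e x y : E} (h : e * x = e * y)
    (h' : (1 - e) * x = (1 - e) * y) : x = y := by
  have := congrArg₂ (· + ·) h h'
  simpa only [← add_mul, add_sub_cancel, one_mul] using this

variable {E : Type u} [Ring E] [Lattice E] [Algebra ℝ E] [IsPhiAlgebra E] {e : E}

theorem nonneg (he : IsIdempotentElem e) : 0 ≤ e := by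
  have := mul_self_nonneg_of_phiAlgebra e
  rwa [he.eq] at this

theorem le_one (he : IsIdempotentElem e) : e ≤ 1 :=
  sub_nonneg.1 (nonneg he.one_sub)

theorem inf_compl (he : IsIdempotentElem e) : e ⊓ (1 - e) = 0 := by
  have h0 := nonneg he
  have h1 := nonneg he.one_sub
  refine le_antisymm ?_ (le_inf h0 h1)
  have h2 : e * (e ⊓ (1 - e)) ≤ 0 := (mul_le_mul_of_nonneg_left inf_le_right h0).trans
    he.mul_one_sub_self.le
  have h3 : (1 - e) * (e ⊓ (1 - e)) ≤ 0 := (mul_le_mul_of_nonneg_left inf_le_left h1).trans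
    he.one_sub_mul_self.le
  calc e ⊓ (1 - e) = e * (e ⊓ (1 - e)) + (1 - e) * (e ⊓ (1 - e)) := by noncomm_ring
    _ ≤ 0 := add_nonpos h2 h3

/-- For `x ≥ 0`, disjointness of `e` and `1 - e` gives `e * x * (1 - e) = 0 = (1 - e) * x * e`, so
both products equal `e * x * e`. -/
theorem commute (he : IsIdempotentElem e) (x : E) : e * x = x * e := by
  have key : ∀ x : E, 0 ≤ x → e * x = x * e := by
    intro x hx
    have h := inf_compl he
    have h1 := mul_eq_zero_of_inf_eq_zero (IsPhiAlgebra.mul_inf_eq_zero e (1 - e) x h hx)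
    have h2 := mul_eq_zero_of_inf_eq_zero
      (IsPhiAlgebra.mul_inf_eq_zero (1 - e) e x ((inf_comm _ _).trans h) hx)
    have h3 : e * x = e * x * e := by
      rw [mul_sub, mul_one, sub_eq_zero] at h1
      exact h1
    have h4 : x * e = e * x * e := by
      rw [sub_mul, one_mul, sub_mul, sub_eq_zero] at h2
      exact h2
    rw [h3, ← h4]
  rw [← posPart_sub_negPart x, mul_sub, sub_mul, key _ (posPart_nonneg x),
    key _ (negPart_nonneg x)]

theorem mul_sup (he : IsIdempotentElem e) (x y : E) : e * (x ⊔ y) = e * x ⊔ e * y := by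
  have h0 := nonneg he
  have h1 := nonneg he.one_sub
  refine le_antisymm ?_ (sup_le (mul_le_mul_of_nonneg_left le_sup_left h0)
    (mul_le_mul_of_nonneg_left le_sup_right h0))
  have h2 : x ⊔ y ≤ (e * x ⊔ e * y) + (1 - e) * (x ⊔ y) := by
    refine sup_le ?_ ?_
    · calc x = e * x + (1 - e) * x := by noncomm_ring
        _ ≤ _ := add_le_add le_sup_left (mul_le_mul_of_nonneg_left le_sup_left h1)
    · calc y = e * y + (1 - e) * y := by noncomm_ring
        _ ≤ _ := add_le_add le_sup_right (mul_le_mul_of_nonneg_left le_sup_right h1)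
  calc e * (x ⊔ y) = x ⊔ y - (1 - e) * (x ⊔ y) := by noncomm_ring
    _ ≤ _ := sub_le_iff_le_add.2 h2

theorem mul_abs (he : IsIdempotentElem e) (x : E) : e * |x| = |e * x| := by
  rw [abs, mul_sup he, mul_neg, abs]

theorem mul_le_self (he : IsIdempotentElem e) {x : E} (hx : 0 ≤ x) : e * x ≤ x := by
  simpa using mul_le_mul_of_nonneg_right (le_one he) hx

theorem mul (he : IsIdempotentElem e) {d : E} (hd : IsIdempotentElem d) :
    IsIdempotentElem (e * d) :=
  IsIdempotentElem.mul_of_commute (commute he d) he hd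

theorem le_of_split {x y : E} (h : e * x ≤ e * y)
    (h' : (1 - e) * x ≤ (1 - e) * y) : x ≤ y := by
  have := add_le_add h h'
  rwa [← add_mul, ← add_mul, add_sub_cancel, one_mul, one_mul] at this

theorem mix_mem_Icc (he : IsIdempotentElem e) {a b x y : E} (hx : x ∈ Set.Icc a b)
    (hy : y ∈ Set.Icc a b) : e * x + (1 - e) * y ∈ Set.Icc a b := by
  constructor
  · refine le_of_split (e := e) ?_ ?_
    · rw [mul_mix he]
      exact mul_le_mul_of_nonneg_left hx.1 (nonneg he)
    · rw [compl_mul_mix he]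
      exact mul_le_mul_of_nonneg_left hy.1 (nonneg he.one_sub)
  · refine le_of_split (e := e) ?_ ?_
    · rw [mul_mix he]
      exact mul_le_mul_of_nonneg_left hx.2 (nonneg he)
    · rw [compl_mul_mix he]
      exact mul_le_mul_of_nonneg_left hy.2 (nonneg he.one_sub)

end Idem

/-! ### Archimedean property and support idempotents -/

section Complete

variable {E : Type u} [Ring E] [ConditionallyCompleteLattice E] [Algebra ℝ E] [IsPhiAlgebra E]

/-- The supremum `s` of the multiples bounds the doubled ones too, so `s ≤ (1 / 2) • s` and hence `s
≤ 0`. -/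
theorem nonpos_of_two_pow_smul_le {z y : E} (h : ∀ n : ℕ, (2 : ℝ) ^ n • z ≤ y) : z ≤ 0 := by
  have hb : BddAbove (Set.range fun n : ℕ => (2 : ℝ) ^ n • z) :=
    ⟨y, by rintro _ ⟨n, rfl⟩; exact h n⟩
  set s := sSup (Set.range fun n : ℕ => (2 : ℝ) ^ n • z) with hs
  have hle : ∀ n : ℕ, (2 : ℝ) ^ n • z ≤ s := fun n => le_csSup hb ⟨n, rfl⟩
  have h1 : s ≤ (1 / 2 : ℝ) • s := by
    refine csSup_le (Set.range_nonempty _) ?_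
    rintro _ ⟨n, rfl⟩
    have := smul_le_smul_of_nonneg_left (hle (n + 1)) (by norm_num : (0 : ℝ) ≤ 1 / 2)
    rw [smul_smul] at this
    convert this using 2
    ring
  have h2 : s ≤ 0 := by
    have h3 : (1 / 2 : ℝ) • s ≤ 0 := by
      have : (1 / 2 : ℝ) • s = s - (1 / 2 : ℝ) • s := by module
      rw [this]
      exact sub_nonpos.2 h1
    exact h1.trans h3
  simpa using (hle 0).trans h2

theorem eq_zero_of_mul_self_eq_zero {w : E} (hw : 0 ≤ w) (h : w * w = 0) : w = 0 := by
  refine le_antisymm (nonpos_of_two_pow_smul_le (y := 1) fun n => ?_) hw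
  -- As `w * w = 0`, this square is `1 - 2 ^ n • w`, so all the multiples `2 ^ n • w` lie below `1`.
  have h1 := mul_self_nonneg_of_phiAlgebra (1 - ((2 : ℝ) ^ n / 2) • w)
  have h2 : (1 - ((2 : ℝ) ^ n / 2) • w) * (1 - ((2 : ℝ) ^ n / 2) • w) = 1 - (2 : ℝ) ^ n • w := by
    rw [sub_mul, mul_sub, mul_sub, smul_mul_smul_comm, h]
    simp only [one_mul, mul_one, smul_zero]
    module
  rw [h2] at h1
  exact sub_nonneg.1 h1

theorem inf_eq_zero_of_mul_eq_zero {x y : E} (hx : 0 ≤ x) (hy : 0 ≤ y) (h : x * y = 0) :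
    x ⊓ y = 0 := by
  have h0 : 0 ≤ x ⊓ y := le_inf hx hy
  exact eq_zero_of_mul_self_eq_zero h0 (le_antisymm
    (h ▸ mul_le_mul inf_le_left inf_le_right h0 hx) (mul_nonneg h0 h0))

/-- The part of `x` in the band generated by `r`. -/
theorem exists_isLUB_inf_nsmul {x r : E} (hx : 0 ≤ x) (hr : 0 ≤ r) :
    ∃ s, IsLUB (Set.range fun n : ℕ => x ⊓ n • r) s ∧ 0 ≤ s ∧ s ≤ x ∧ (x - s) ⊓ r = 0 := by
  have hb : BddAbove (Set.range fun n : ℕ => x ⊓ n • r) :=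
    ⟨x, by rintro _ ⟨n, rfl⟩; exact inf_le_left⟩
  have hl := isLUB_csSup (Set.range_nonempty _) hb
  set s := sSup (Set.range fun n : ℕ => x ⊓ n • r)
  have hsx : s ≤ x := hl.2 (by rintro _ ⟨n, rfl⟩; exact inf_le_left)
  have hw : 0 ≤ (x - s) ⊓ r := le_inf (sub_nonneg.2 hsx) hr
  refine ⟨s, hl, ?_, hsx, le_antisymm ?_ hw⟩
  · have := hl.1 ⟨0, rfl⟩
    simpa [hx] using this
  -- Adding `(x - s) ⊓ r` to the `n`-th term stays below the next term, so `s` absorbs it.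
  · have : s ≤ s - (x - s) ⊓ r := by
      refine hl.2 ?_
      rintro _ ⟨n, rfl⟩
      refine le_sub_iff_add_le.2 (le_trans ?_ (hl.1 ⟨n + 1, rfl⟩))
      refine le_inf ?_ ?_
      · calc x ⊓ n • r + (x - s) ⊓ r ≤ s + (x - s) := add_le_add (hl.1 ⟨n, rfl⟩) inf_le_left
          _ = x := by abel
      · rw [succ_nsmul]
        exact add_le_add inf_le_right inf_le_right
    simpa using this

theorem inf_nsmul_eq_zero {x y : E} (h : y ⊓ x = 0) (n : ℕ) : y ⊓ n • x = 0 := by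
  have := IsPhiAlgebra.mul_inf_eq_zero x y (n : E) ((inf_comm _ _).trans h) (Nat.cast_nonneg n)
  rwa [inf_comm, nsmul_eq_mul, Nat.cast_comm]

theorem inf_eq_zero_of_isLUB {S : Set E} {s y : E} (hs : IsLUB S s) (hs0 : 0 ≤ s) (hy : 0 ≤ y)
    (h : ∀ x ∈ S, y ⊓ x = 0) : y ⊓ s = 0 := by
  refine le_antisymm ?_ (le_inf hy hs0)
  have h1 : s ≤ y ⊔ s - y := hs.2 fun x hx => by
    rw [le_sub_iff_add_le]
    have := inf_add_sup y x
    rw [h x hx, zero_add] at this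
    rw [add_comm, ← this]
    exact sup_le_sup_left (hs.1 hx) _
  have h2 : y ⊓ s = y + s - y ⊔ s := eq_sub_of_add_eq (inf_add_sup y s)
  rw [h2, sub_nonpos, add_comm]
  exact le_sub_iff_add_le.1 h1

/-- Existence of the support idempotent of a positive element. -/
theorem exists_support {u : E} (hu : 0 ≤ u) :
    ∃ e : E, IsIdempotentElem e ∧ e * u = u ∧ ∀ y, 0 ≤ y → y ⊓ u = 0 → e * y = 0 := by
  -- The support is the part of `1` in the band of `u`. The rest `1 - e` is disjoint from `u`, hence
  -- from `e`, which makes `e` idempotent.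
  obtain ⟨e, he, he0, he1, hd⟩ := exists_isLUB_inf_nsmul (zero_le_one' E) hu
  have key : ∀ y, 0 ≤ y → y ⊓ u = 0 → y ⊓ e = 0 := fun y hy hyu => by
    refine inf_eq_zero_of_isLUB he he0 hy ?_
    rintro _ ⟨n, rfl⟩
    refine le_antisymm ?_ (le_inf hy (le_inf zero_le_one (nsmul_nonneg hu n)))
    exact (inf_le_inf_left y inf_le_right).trans (inf_nsmul_eq_zero hyu n).le
  refine ⟨e, ?_, ?_, fun y hy hyu =>
    mul_eq_zero_of_inf_eq_zero ((inf_comm _ _).trans (key y hy hyu))⟩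
  · have := mul_eq_zero_of_inf_eq_zero (key _ (sub_nonneg.2 he1) hd)
    rw [sub_mul, one_mul, sub_eq_zero] at this
    exact this.symm
  · have := mul_eq_zero_of_inf_eq_zero hd
    rw [sub_mul, one_mul, sub_eq_zero] at this
    exact this.symm

theorem exists_support_idem {u : E} (hu : 0 ≤ u) :
    ∃ e : E, IsIdempotentElem e ∧ e * u = u ∧
      ∀ d, IsIdempotentElem d → d * u = 0 → d * e = 0 := by
  obtain ⟨e, he, h1, h2⟩ := exists_support hu
  refine ⟨e, he, h1, fun d hd h => ?_⟩
  rw [← Idem.commute he]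
  exact h2 d (Idem.nonneg hd) (inf_eq_zero_of_mul_eq_zero (Idem.nonneg hd) hu h)

/-- The support of `h⁺` annihilates `h⁻`. This splitting stands in for the dichotomy `0 ≤ h` or `h ≤
0`. -/
theorem exists_sign (h : E) : ∃ e : E, IsIdempotentElem e ∧ 0 ≤ e * h ∧ (1 - e) * h ≤ 0 ∧
    e * h = h⁺ := by
  obtain ⟨e, he, h1, h2⟩ := exists_support (posPart_nonneg h)
  have h3 := h2 h⁻ (negPart_nonneg h) ((inf_comm _ _).trans (posPart_inf_negPart_eq_zero h))
  have h4 : e * h = h⁺ := by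
    conv_lhs => rw [← posPart_sub_negPart h]
    rw [mul_sub, h1, h3, sub_zero]
  refine ⟨e, he, ?_, ?_, h4⟩
  · rw [h4]; exact posPart_nonneg h
  · rw [sub_mul, one_mul, h4, sub_nonpos]
    exact le_posPart h

/-! ### Weak order units -/

theorem isBand_disjoint (y : E) (hy : 0 ≤ y) : ∃ B : Submodule ℝ E, IsBand B ∧
    ∀ x, x ∈ B ↔ |x| ⊓ y = 0 := by
  have mono : ∀ {p q : E}, 0 ≤ p → p ≤ q → q ⊓ y = 0 → p ⊓ y = 0 := fun hp hpq h =>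
    le_antisymm ((inf_le_inf_right y hpq).trans h.le) (le_inf hp hy)
  have two : ∀ {p : E}, 0 ≤ p → p ⊓ y = 0 → ∀ c : ℝ, 0 ≤ c → (c • p) ⊓ y = 0 := by
    intro p hp h c hc
    have := IsPhiAlgebra.mul_inf_eq_zero p y (algebraMap ℝ E c) h (by
      rw [Algebra.algebraMap_eq_smul_one]; exact smul_nonneg hc zero_le_one)
    rwa [← Algebra.commutes, ← Algebra.smul_def] at this
  refine ⟨{ carrier := {x | |x| ⊓ y = 0}, add_mem' := ?_, zero_mem' := ?_, smul_mem' := ?_ },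
    ⟨?_, ?_⟩, fun x => Iff.rfl⟩
  · intro p q hp hq
    refine mono (abs_nonneg _) (abs_add_le p q) ?_
    have h1 : |p| + |q| ≤ (2 : ℝ) • (|p| ⊔ |q|) := by
      rw [two_smul]; exact add_le_add le_sup_left le_sup_right
    refine mono (add_nonneg (abs_nonneg _) (abs_nonneg _)) h1
      (two ((abs_nonneg p).trans le_sup_left) ?_ 2 zero_le_two)
    let _ : DistribLattice E := AddCommGroup.toDistribLattice E
    have h2 := inf_sup_right |p| |q| y
    change |p| ⊓ y = 0 at hp
    change |q| ⊓ y = 0 at hq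
    refine h2.trans ?_
    rw [hp, hq, sup_idem]
  · simp [hy]
  · intro c x hx
    refine mono (abs_nonneg _) (q := |c| • |x|) ?_ (two (abs_nonneg x) hx _ (abs_nonneg c))
    refine abs_le'.2 ⟨?_, ?_⟩
    · rcases le_total 0 c with hc | hc
      · rw [abs_of_nonneg hc]; exact smul_le_smul_of_nonneg_left (le_abs_self x) hc
      · rw [abs_of_nonpos hc, ← neg_smul_neg]
        exact smul_le_smul_of_nonneg_left (neg_le_abs x) (neg_nonneg.2 hc)
    · rcases le_total 0 c with hc | hc
      · rw [abs_of_nonneg hc, ← smul_neg]; exact smul_le_smul_of_nonneg_left (neg_le_abs x) hc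
      · rw [abs_of_nonpos hc, ← neg_smul]
        exact smul_le_smul_of_nonneg_left (le_abs_self x) (neg_nonneg.2 hc)
  · intro x hx z hz
    exact mono (abs_nonneg _) hz hx
  · intro S hS x hx
    have hpos : ∀ z ∈ S, y ⊓ z⁺ = 0 := fun z hz => by
      rw [inf_comm]
      exact mono (posPart_nonneg z) (sup_le (le_abs_self z) (abs_nonneg z)) (hS hz)
    have h0 : x⁺ ⊓ y = 0 := by
      rw [inf_comm]
      refine inf_eq_zero_of_isLUB (S := insert 0 ((fun z => z⁺) '' S)) ⟨?_, ?_⟩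
        (posPart_nonneg x) hy ?_
      · rintro _ (rfl | ⟨z, hz, rfl⟩)
        · exact posPart_nonneg x
        · exact posPart_mono (hx.1 hz)
      · intro w hw
        have hw0 : 0 ≤ w := hw (Set.mem_insert _ _)
        exact sup_le (hx.2 fun z hz => (le_posPart z).trans
          (hw (Set.mem_insert_of_mem _ ⟨z, hz, rfl⟩))) hw0
      · rintro _ (rfl | ⟨z, hz, rfl⟩)
        · simp [hy]
        · exact hpos z hz
    rcases S.eq_empty_or_nonempty with rfl | ⟨z, hz⟩
    -- A supremum of the empty set is a least element, which can only be `0`.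
    · have hbot : ∀ w : E, x ≤ w := fun w => hx.2 (by simp)
      have hx0 : x ≤ x + x := hbot _
      have hx1 : x = 0 := le_antisymm (hbot 0) (by simpa using hx0)
      simp [hx1]
    · have h1 : x⁻ ⊓ y = 0 := by
        refine mono (negPart_nonneg x) ((negPart_anti (hx.1 hz)).trans ?_) (hS hz)
        exact sup_le (neg_le_abs z) (abs_nonneg z)
      let _ : DistribLattice E := AddCommGroup.toDistribLattice E
      have h2 := inf_sup_right x⁺ x⁻ y
      change |x| ⊓ y = 0
      have h3 : |x| ≤ (2 : ℝ) • (x⁺ ⊔ x⁻) := by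
        rw [two_smul, ← posPart_add_negPart]
        exact add_le_add le_sup_left le_sup_right
      refine mono (abs_nonneg x) h3 (two ((posPart_nonneg x).trans le_sup_left) ?_ 2 zero_le_two)
      refine h2.trans ?_
      rw [h0, h1, sup_idem]

/-- The disjoint complement of `y` is a band containing `r`, so it is all of `E` and contains `y`.
-/
theorem IsWeakOrderUnit.eq_zero {r : E} (hr : IsWeakOrderUnit r) {y : E} (hy : 0 ≤ y)
    (h : r ⊓ y = 0) : y = 0 := by
  obtain ⟨B, hB, hmem⟩ := isBand_disjoint y hy
  have h1 : bandGenerated r ≤ B := sInf_le ⟨hB, (hmem r).2 (by rwa [abs_of_nonneg hr.1])⟩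
  rw [hr.2] at h1
  have h2 := (hmem y).1 (h1 Submodule.mem_top)
  rwa [abs_of_nonneg hy, inf_idem] at h2

/-- What `x ≥ 0` leaves outside the band of `r` is disjoint from `r`, so `x` is the supremum of the
elements `x ⊓ n • r`. -/
theorem isWeakOrderUnit_of_forall {r : E} (hr : 0 ≤ r)
    (h : ∀ y : E, 0 ≤ y → r ⊓ y = 0 → y = 0) : IsWeakOrderUnit r := by
  refine ⟨hr, ?_⟩
  rw [bandGenerated, sInf_eq_top]
  rintro B ⟨hB, hrB⟩
  have key : ∀ x : E, 0 ≤ x → x ∈ B := fun x hx => by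
    obtain ⟨s, hs, hs0, hsx, hd⟩ := exists_isLUB_inf_nsmul hx hr
    have h1 := h (x - s) (sub_nonneg.2 hsx) ((inf_comm _ _).trans hd)
    rw [sub_eq_zero.1 h1]
    refine hB.sup_mem _ ?_ s hs
    rintro _ ⟨n, rfl⟩
    have h2 : n • r ∈ B := B.toAddSubmonoid.nsmul_mem hrB n
    refine hB.solid _ h2 _ ?_
    have h3 := nsmul_nonneg hr n
    rw [abs_of_nonneg h3, abs_of_nonneg (le_inf hx h3)]
    exact inf_le_right
  rw [eq_top_iff]
  intro x _
  rw [← posPart_sub_negPart x]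
  exact B.sub_mem (key _ (posPart_nonneg x)) (key _ (negPart_nonneg x))

theorem IsWeakOrderUnit.idem_eq_zero {r : E} (hr : IsWeakOrderUnit r) {d : E}
    (hd : IsIdempotentElem d) (h : d * r = 0) : d = 0 :=
  hr.eq_zero (Idem.nonneg hd) ((inf_comm _ _).trans
    (inf_eq_zero_of_mul_eq_zero (Idem.nonneg hd) hr.1 h))

theorem isWeakOrderUnit_of_idem {r : E} (hr : 0 ≤ r)
    (h : ∀ d : E, IsIdempotentElem d → d * r = 0 → d = 0) : IsWeakOrderUnit r := by
  refine isWeakOrderUnit_of_forall hr fun y hy hry => ?_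
  obtain ⟨e, he, h1, h2⟩ := exists_support hy
  rw [← h1, h e he (h2 r hr hry), zero_mul]

theorem IsWeakOrderUnit.mono {r s : E} (hr : IsWeakOrderUnit r) (h : r ≤ s) :
    IsWeakOrderUnit s :=
  isWeakOrderUnit_of_forall (hr.1.trans h) fun _ hy hs =>
    hr.eq_zero hy (le_antisymm ((inf_le_inf_right _ h).trans hs.le) (le_inf hr.1 hy))

theorem IsWeakOrderUnit.smul {r : E} (hr : IsWeakOrderUnit r) {t : ℝ} (ht : 0 < t) :
    IsWeakOrderUnit (t • r) := by
  refine isWeakOrderUnit_of_idem (smul_nonneg ht.le hr.1) fun d hd h => hr.idem_eq_zero hd ?_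
  rw [mul_smul_comm] at h
  exact (smul_eq_zero.1 h).resolve_left ht.ne'

theorem IsWeakOrderUnit.nonpos_of_mul_nonpos {l z : E} (hl : IsWeakOrderUnit l)
    (h : l * z ≤ 0) : z ≤ 0 := by
  obtain ⟨e, he, h1, -, h3⟩ := exists_sign z
  have h4 : l * z⁺ ≤ 0 := by
    rw [← h3, ← mul_assoc, ← Idem.commute he, mul_assoc]
    simpa using mul_le_mul_of_nonneg_left h (Idem.nonneg he)
  have h5 : l * z⁺ = 0 := le_antisymm h4 (mul_nonneg hl.1 (posPart_nonneg z))
  have h6 := hl.eq_zero (posPart_nonneg z) (inf_eq_zero_of_mul_eq_zero hl.1 (posPart_nonneg z) h5)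
  exact (le_posPart z).trans h6.le

end Complete

/-! ### Order moduli and local functions -/

section Calculus

variable {E : Type u} [Ring E] [ConditionallyCompleteLattice E] [Algebra ℝ E] [IsPhiAlgebra E]

/-- The set of dyadic fractions of `l`. -/
def dyadic {E : Type u} [Ring E] [Algebra ℝ E] (l : E) : Set E :=
  Set.range fun n : ℕ => (1 / 2 : ℝ) ^ n • l

theorem half_pow_smul_anti {l : E} (hl : 0 ≤ l) :
    Antitone fun n : ℕ => (1 / 2 : ℝ) ^ n • l := fun _ _ h =>
  smul_le_smul_of_nonneg_right (pow_le_pow_of_le_one (by norm_num) (by norm_num) h) hl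

theorem dyadic_nonempty {E : Type u} [Ring E] [Algebra ℝ E] (l : E) :
    (dyadic l).Nonempty := Set.range_nonempty _

theorem dyadic_directed {l : E} (hl : 0 ≤ l) : DirectedOn (· ≥ ·) (dyadic l) := by
  rintro _ ⟨m, rfl⟩ _ ⟨n, rfl⟩
  exact ⟨_, ⟨max m n, rfl⟩, half_pow_smul_anti hl (le_max_left _ _),
    half_pow_smul_anti hl (le_max_right _ _)⟩

theorem half_pow_nonneg (n : ℕ) : (0 : ℝ) ≤ (1 / 2) ^ n := by positivity

theorem dyadic_isGLB {l : E} (hl : 0 ≤ l) : IsGLB (dyadic l) 0 := by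
  refine ⟨?_, fun z hz => nonpos_of_two_pow_smul_le (y := l) fun n => ?_⟩
  · rintro _ ⟨n, rfl⟩
    exact smul_nonneg (half_pow_nonneg n) hl
  · have h1 := smul_le_smul_of_nonneg_left (hz ⟨n, rfl⟩) (by positivity : (0 : ℝ) ≤ 2 ^ n)
    rw [smul_smul, ← mul_pow] at h1
    simpa using h1

theorem nonpos_of_le_add {S T : Set E} (hS : IsGLB S 0) (hT : IsGLB T 0) {x : E}
    (h : ∀ s ∈ S, ∀ t ∈ T, x ≤ s + t) : x ≤ 0 :=
  hT.2 fun t ht => sub_nonpos.1 (hS.2 fun s hs => sub_le_iff_le_add.2 (h s hs t ht))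

theorem abs_sub_le_of_mem_Icc {a b x y : E} (hx : x ∈ Set.Icc a b) (hy : y ∈ Set.Icc a b) :
    |x - y| ≤ b - a :=
  abs_le'.2 ⟨sub_le_sub hx.2 hy.1, by rw [neg_sub]; exact sub_le_sub hy.2 hx.1⟩

/-- Order continuity expressed by moduli of continuity in place of nets. -/
def HasOrderModulusOn (f : E → E) (D : Set E) : Prop :=
  ∀ c ∈ D, ∀ Δ : Set E, Δ.Nonempty → DirectedOn (· ≥ ·) Δ → IsGLB Δ 0 →
    ∃ S : Set E, IsGLB S 0 ∧ ∀ ε ∈ S, ∃ δ ∈ Δ, ∀ z ∈ D, |z - c| ≤ δ → |f z - f c| ≤ ε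

/-- The index type of the net of all points of `D` together with a bound from `Δ` for their
distance from `c`. -/
structure ModulusIndex (Δ D : Set E) (c : E) : Type u where
  bound : E
  point : E
  bound_mem : bound ∈ Δ
  point_mem : point ∈ D
  abs_le : |point - c| ≤ bound

/-- Only bounds are compared, in reverse, so a tail of the net contains every point of `D` within
the given bound. -/
instance (Δ D : Set E) (c : E) : Preorder (ModulusIndex Δ D c) :=
  Preorder.lift fun p => OrderDual.toDual p.bound

theorem OrderContinuousOn.hasOrderModulusOn {f : E → E} {D : Set E} (hf : OrderContinuousOn f D) :
    HasOrderModulusOn f D := by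
  intro c hc Δ hne hdir hglb
  have base : ∀ δ ∈ Δ, ∃ p : ModulusIndex Δ D c, p.bound = δ := fun δ hδ =>
    ⟨⟨δ, c, hδ, hc, by simpa using hglb.1 hδ⟩, rfl⟩
  obtain ⟨δ₀, hδ₀⟩ := hne
  have : Nonempty (ModulusIndex Δ D c) := ⟨(base δ₀ hδ₀).choose⟩
  have : IsDirectedOrder (ModulusIndex Δ D c) := ⟨fun p q => by
    obtain ⟨δ, hδ, h1, h2⟩ := hdir _ p.bound_mem _ q.bound_mem
    obtain ⟨r, rfl⟩ := base δ hδ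
    exact ⟨r, h1, h2⟩⟩
  obtain ⟨S, hS, h⟩ := hf c hc (ModulusIndex Δ D c) (fun p => p.point) (fun p => p.point_mem)
    ⟨Δ, hglb, fun δ hδ => by
      obtain ⟨r, rfl⟩ := base δ hδ
      exact ⟨r, fun p hp => p.abs_le.trans hp⟩⟩
  refine ⟨S, hS, fun ε hε => ?_⟩
  obtain ⟨p, hp⟩ := h ε hε
  exact ⟨p.bound, p.bound_mem, fun z hz hzc =>
    hp ⟨p.bound, z, p.bound_mem, hz, hzc⟩ (le_refl p.bound)⟩

theorem HasOrderModulusOn.le_of_approx {f : E → E} {D : Set E} (hf : HasOrderModulusOn f D)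
    {c y : E} (hc : c ∈ D) {Δ : Set E} (hne : Δ.Nonempty) (hdir : DirectedOn (· ≥ ·) Δ)
    (hglb : IsGLB Δ 0) (h : ∀ δ ∈ Δ, ∃ z ∈ D, |z - c| ≤ δ ∧ f z ≤ y) : f c ≤ y := by
  obtain ⟨S, hS, hSδ⟩ := hf c hc Δ hne hdir hglb
  refine sub_nonpos.1 (hS.2 fun ε hε => ?_)
  obtain ⟨δ, hδ, h1⟩ := hSδ ε hε
  obtain ⟨z, hz, hzc, hzy⟩ := h δ hδ
  calc f c - y ≤ f c - f z := sub_le_sub_left hzy _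
    _ = -(f z - f c) := (neg_sub _ _).symm
    _ ≤ ε := (neg_le_abs _).trans (h1 z hz hzc)

theorem HasOrderModulusOn.mul_sub_shift {f : E → E} {D D' : Set E} (hf : HasOrderModulusOn f D)
    {k l : E} (hD : ∀ x ∈ D', x ∈ D ∧ x + l ∈ D) (hk : ∀ w : E, |k * w| ≤ |w|) :
    HasOrderModulusOn (fun x => k * (f (x + l) - f x)) D' := by
  intro c hc Δ hne hdir hglb
  obtain ⟨S, hS, h1⟩ := hf _ (hD c hc).1 Δ hne hdir hglb
  obtain ⟨T, hT, h2⟩ := hf _ (hD c hc).2 Δ hne hdir hglb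
  refine ⟨{x | ∃ s ∈ S, ∃ t ∈ T, x = s + t}, ⟨?_, ?_⟩, ?_⟩
  · rintro _ ⟨s, hs, t, ht, rfl⟩
    exact add_nonneg (hS.1 hs) (hT.1 ht)
  · exact fun z hz => nonpos_of_le_add hS hT fun s hs t ht => hz ⟨s, hs, t, ht, rfl⟩
  · rintro _ ⟨s, hs, t, ht, rfl⟩
    obtain ⟨δ₁, hδ₁, h1⟩ := h1 s hs
    obtain ⟨δ₂, hδ₂, h2⟩ := h2 t ht
    obtain ⟨δ, hδ, hle₁, hle₂⟩ := hdir _ hδ₁ _ hδ₂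
    refine ⟨δ, hδ, fun z hz hzc => ?_⟩
    have h3 := h1 z (hD z hz).1 (hzc.trans hle₁)
    have h4 := h2 (z + l) (hD z hz).2 (by rw [add_sub_add_right_eq_sub]; exact hzc.trans hle₂)
    rw [← mul_sub]
    refine (hk _).trans ?_
    calc |f (z + l) - f z - (f (c + l) - f c)|
        = |-(f z - f c) + (f (z + l) - f (c + l))| := by congr 1; abel
      _ ≤ |-(f z - f c)| + |f (z + l) - f (c + l)| := abs_add_le _ _
      _ ≤ s + t := by rw [abs_neg]; exact add_le_add h3 h4

/-- The value of `f` on each component depends only on the component of the argument. -/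
def IsLocalOn (f : E → E) (D : Set E) : Prop :=
  ∀ e : E, IsIdempotentElem e → ∀ x ∈ D, ∀ y ∈ D, e * x = e * y → e * f x = e * f y

theorem IsLocalOn.mul_sub_shift {f : E → E} {D D' : Set E} (hf : IsLocalOn f D)
    {k l : E} (hD : ∀ x ∈ D', x ∈ D ∧ x + l ∈ D) :
    IsLocalOn (fun x => k * (f (x + l) - f x)) D' := by
  intro e he x hx y hy hxy
  have h1 := hf e he x (hD x hx).1 y (hD y hy).1 hxy
  have h2 := hf e he (x + l) (hD x hx).2 (y + l) (hD y hy).2 (by rw [mul_add, hxy, mul_add])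
  simp only [← mul_assoc, Idem.commute he k]
  rw [mul_assoc, mul_assoc, mul_sub, mul_sub e, h1, h2]

/-! ### The intermediate value theorem -/

/-- The zero is `c`, the supremum of the points where `g ≤ 0`. Locality closes this set under `⊔`,
so it approximates `c` along a directed set and `g c ≤ 0`. For the converse, `g` is shown to be
nonnegative at points slightly towards `q`. -/
theorem exists_zero_of_nonpos_of_nonneg {g : E → E} {p q : E} (hpq : p ≤ q)
    (hg : HasOrderModulusOn g (Set.Icc p q)) (hl : IsLocalOn g (Set.Icc p q)) (hp : g p ≤ 0)
    (hq : 0 ≤ g q) : ∃ c ∈ Set.Icc p q, g c = 0 := by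
  set S : Set E := {x | x ∈ Set.Icc p q ∧ g x ≤ 0} with hSdef
  have hpS : p ∈ S := ⟨⟨le_rfl, hpq⟩, hp⟩
  have hub : BddAbove S := ⟨q, fun x hx => hx.1.2⟩
  have hlub := isLUB_csSup ⟨p, hpS⟩ hub
  set c := sSup S
  have hc : c ∈ Set.Icc p q := ⟨hlub.1 hpS, hlub.2 fun x hx => hx.1.2⟩
  have hsup : ∀ x ∈ S, ∀ y ∈ S, x ⊔ y ∈ S := by
    intro x hx y hy
    have hxy : x ⊔ y ∈ Set.Icc p q := ⟨hx.1.1.trans le_sup_left, sup_le hx.1.2 hy.1.2⟩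
    refine ⟨hxy, ?_⟩
    obtain ⟨e, he, h1, h2, -⟩ := exists_sign (x - y)
    rw [mul_sub] at h1 h2
    have h3 : e * (x ⊔ y) = e * x := by
      rw [Idem.mul_sup he, sup_eq_left]; exact sub_nonneg.1 h1
    have h4 : (1 - e) * (x ⊔ y) = (1 - e) * y := by
      rw [Idem.mul_sup he.one_sub, sup_eq_right]; exact sub_nonpos.1 h2
    refine Idem.le_of_split (e := e) ?_ ?_
    · rw [hl e he _ hxy _ hx.1 h3]
      exact mul_le_mul_of_nonneg_left hx.2 (Idem.nonneg he)
    · rw [hl _ he.one_sub _ hxy _ hy.1 h4]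
      exact mul_le_mul_of_nonneg_left hy.2 (Idem.nonneg he.one_sub)
  have hgc : g c ≤ 0 := by
    refine hg.le_of_approx hc (Δ := (fun x => c - x) '' S) ⟨_, p, hpS, rfl⟩ ?_ ⟨?_, ?_⟩ ?_
    · rintro _ ⟨x, hx, rfl⟩ _ ⟨y, hy, rfl⟩
      exact ⟨_, ⟨_, hsup x hx y hy, rfl⟩, sub_le_sub_left le_sup_left _,
        sub_le_sub_left le_sup_right _⟩
    · rintro _ ⟨x, hx, rfl⟩
      exact sub_nonneg.2 (hlub.1 hx)
    · intro z hz
      have : c ≤ c - z := hlub.2 fun x hx => le_sub_comm.1 (hz ⟨x, hx, rfl⟩)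
      simpa using this
    · rintro _ ⟨x, hx, rfl⟩
      refine ⟨x, hx.1, ?_, hx.2⟩
      rw [abs_sub_comm, abs_of_nonneg (sub_nonneg.2 (hlub.1 hx))]
  refine ⟨c, hc, le_antisymm hgc ?_⟩
  have hqc : 0 ≤ q - c := sub_nonneg.2 hc.2
  have hneg : HasOrderModulusOn (fun x => -g x) (Set.Icc p q) := by
    intro d hd Δ h1 h2 h3
    obtain ⟨T, hT, h⟩ := hg d hd Δ h1 h2 h3
    refine ⟨T, hT, fun ε hε => ?_⟩
    obtain ⟨δ, hδ, h⟩ := h ε hε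
    refine ⟨δ, hδ, fun z hz hzd => ?_⟩
    rw [← neg_sub', abs_neg]
    exact h z hz hzd
  refine neg_nonpos.1 (hneg.le_of_approx hc (dyadic_nonempty (q - c)) (dyadic_directed hqc)
    (dyadic_isGLB hqc) ?_)
  rintro _ ⟨n, rfl⟩
  beta_reduce
  have ht0 := half_pow_nonneg n
  have ht1 : (1 / 2 : ℝ) ^ n ≤ 1 := pow_le_one₀ (by norm_num) (by norm_num)
  have htp : (0 : ℝ) < (1 / 2 : ℝ) ^ n := by positivity
  generalize (1 / 2 : ℝ) ^ n = t at ht0 ht1 htp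
  have hd0 : 0 ≤ t • (q - c) := smul_nonneg ht0 hqc
  have hd1 : t • (q - c) ≤ q - c := by
    simpa using smul_le_smul_of_nonneg_right ht1 hqc
  have hy : c + t • (q - c) ∈ Set.Icc p q := ⟨hc.1.trans (le_add_of_nonneg_right hd0), by
    calc c + t • (q - c) ≤ c + (q - c) := by gcongr
      _ = q := by abel⟩
  refine ⟨c + t • (q - c), hy, by rw [add_sub_cancel_left, abs_of_nonneg hd0],
    neg_nonpos.2 ?_⟩
  set y := c + t • (q - c) with hydef
  obtain ⟨e, he, h1, h2, -⟩ := exists_sign (g y)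
  have he1 := he.one_sub
  have hz := Idem.mix_mem_Icc he hc hy
  -- Moving from `c` to `y` only where `g y ≤ 0` stays in `S`, so it cannot pass `c`; there `c`
  -- already equals `q`.
  have hzc : e * c + (1 - e) * y ≤ c := by
    refine hlub.1 ⟨hz, Idem.le_of_split (e := e) ?_ ?_⟩
    · rw [hl e he _ hz c hc (Idem.mul_mix he _ _)]
      exact mul_le_mul_of_nonneg_left hgc (Idem.nonneg he)
    · rw [hl _ he1 _ hz y hy (Idem.compl_mul_mix he _ _), mul_zero]
      exact h2
  have h3 : (1 - e) * (q - c) = 0 := by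
    refine le_antisymm ?_ (mul_nonneg (Idem.nonneg he1) hqc)
    have h4 := mul_le_mul_of_nonneg_left hzc (Idem.nonneg he1)
    rw [Idem.compl_mul_mix he, hydef, mul_add, add_le_iff_nonpos_right, mul_smul_comm] at h4
    exact le_of_smul_le_smul_left (h4.trans (smul_zero t).ge) htp
  have h5 : (1 - e) * y = (1 - e) * q := by
    rw [hydef, mul_add, mul_smul_comm, h3, smul_zero, add_zero]
    rw [mul_sub, sub_eq_zero] at h3
    exact h3.symm
  refine Idem.le_of_split (e := e) (by rwa [mul_zero]) ?_
  rw [hl _ he1 _ hy q ⟨hpq, le_rfl⟩ h5, mul_zero]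
  exact mul_nonneg (Idem.nonneg he1) hq

end Calculus

section Rolle

variable {E : Type u} [Ring E] [ConditionallyCompleteLattice E] [Algebra ℝ E] [IsPhiAlgebra E]

/-! ### Locality of differentiable functions -/

theorem segment_sub_eq {E : Type u} [Ring E] [Algebra ℝ E] (a x y : E) (t : ℝ) :
    x + t • (y - x) - a = (1 - t) • (x - a) + t • (y - a) := by module

theorem sub_segment_eq {E : Type u} [Ring E] [Algebra ℝ E] (b x y : E) (t : ℝ) :
    b - (x + t • (y - x)) = (1 - t) • (b - x) + t • (b - y) := by module

theorem segment_mem_openInterval_of_Icc {a b x y : E} (hx : x ∈ Set.Icc a b)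
    (hy : y ∈ openInterval a b) {t : ℝ} (ht : 0 < t) (ht1 : t ≤ 1) :
    x + t • (y - x) ∈ openInterval a b := by
  have h1 : 0 ≤ 1 - t := sub_nonneg.2 ht1
  constructor
  · refine IsWeakOrderUnit.mono (hy.1.smul ht) ?_
    rw [segment_sub_eq]
    exact le_add_of_nonneg_left (smul_nonneg h1 (sub_nonneg.2 hx.1))
  · refine IsWeakOrderUnit.mono (hy.2.smul ht) ?_
    rw [sub_segment_eq]
    exact le_add_of_nonneg_left (smul_nonneg h1 (sub_nonneg.2 hx.2))

theorem openInterval_subset_Icc {a b : E} : openInterval a b ⊆ Set.Icc a b := fun _ hx =>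
  ⟨sub_nonneg.1 hx.1.1, sub_nonneg.1 hx.2.1⟩

theorem segment_mem_openInterval {a b x y : E} (hx : x ∈ openInterval a b)
    (hy : y ∈ openInterval a b) {t : ℝ} (ht : 0 ≤ t) (ht1 : t ≤ 1) :
    x + t • (y - x) ∈ openInterval a b := by
  rcases ht.eq_or_lt with rfl | h
  · simpa using hx
  · exact segment_mem_openInterval_of_Icc (openInterval_subset_Icc hx) hy h ht1

theorem subsingleton_of_isGLB_empty (h : IsGLB (∅ : Set E) 0) : Subsingleton E := by
  have h1 : ∀ x : E, x ≤ 0 := fun x => h.2 (by simp)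
  have h2 : ∀ x : E, x = 0 := fun x => le_antisymm (h1 x) (neg_nonpos.1 (h1 (-x)))
  exact ⟨fun x y => (h2 x).trans (h2 y).symm⟩

/-- Along the segment from `x` to `y`, increments are killed by `e`, and with them both the linear
term and the error bound. So `e * f` is locally constant in the real parameter, hence constant on
the connected unit interval. -/
theorem isLocalOn_openInterval {f f' : E → E} {a b : E}
    (hdiff : ∀ x ∈ openInterval a b, HasSuperOrderDerivAt f (Set.Icc a b) x (f' x)) :
    IsLocalOn f (openInterval a b) := by
  intro e he x hx y hy hxy
  have he0 : e * (y - x) = 0 := by rw [mul_sub, hxy, sub_self]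
  have he1 : e * |y - x| = 0 := by rw [Idem.mul_abs he, he0, abs_zero]
  let φ : unitInterval → E := fun t => e * f (x + (t : ℝ) • (y - x))
  have hφ : IsLocallyConstant φ := by
    rw [IsLocallyConstant.iff_eventually_eq]
    intro t
    have hz := segment_mem_openInterval hx hy t.2.1 t.2.2
    obtain ⟨-, r, -, -, h⟩ := hdiff _ hz
    obtain ⟨S, hS, h⟩ := h (dyadic |y - x|) (dyadic_nonempty _) (dyadic_directed (abs_nonneg _))
      (dyadic_isGLB (abs_nonneg _))
    rcases S.eq_empty_or_nonempty with rfl | ⟨ε, hε⟩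
    · have := subsingleton_of_isGLB_empty hS
      exact Filter.Eventually.of_forall fun s => Subsingleton.elim _ _
    obtain ⟨_, ⟨n, rfl⟩, h⟩ := h ε hε
    have hpos : (0 : ℝ) < (1 / 2) ^ n := by positivity
    filter_upwards [Metric.ball_mem_nhds t hpos] with s hs
    have hst : |(s : ℝ) - t| ≤ (1 / 2) ^ n := by
      rw [Metric.mem_ball, Subtype.dist_eq, Real.dist_eq] at hs
      exact hs.le
    have hzs := openInterval_subset_Icc (segment_mem_openInterval hx hy s.2.1 s.2.2)
    have hsub : x + (s : ℝ) • (y - x) - (x + (t : ℝ) • (y - x)) = ((s : ℝ) - t) • (y - x) := by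
      module
    have habs : |((s : ℝ) - t) • (y - x)| ≤ |(s : ℝ) - t| • |y - x| := by
      rcases abs_cases ((s : ℝ) - t) with ⟨h1, h2⟩ | ⟨h1, h2⟩
      · rw [h1]
        exact abs_le'.2 ⟨smul_le_smul_of_nonneg_left (le_abs_self _) h2,
          by rw [← smul_neg]; exact smul_le_smul_of_nonneg_left (neg_le_abs _) h2⟩
      · rw [h1]
        have h3 : 0 ≤ -((s : ℝ) - t) := by linarith
        exact abs_le'.2 ⟨by rw [← neg_smul_neg]; exact smul_le_smul_of_nonneg_left (neg_le_abs _) h3,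
          by rw [← neg_smul]; exact smul_le_smul_of_nonneg_left (le_abs_self _) h3⟩
    have h1 := h _ hzs (by
      rw [hsub]
      exact habs.trans (smul_le_smul_of_nonneg_right hst (abs_nonneg _)))
    rw [hsub] at h1
    have h2 := mul_le_mul_of_nonneg_left h1 (Idem.nonneg he)
    rw [← mul_assoc, Idem.mul_abs he, Idem.mul_abs he, mul_smul_comm, he0, smul_zero, abs_zero,
      zero_mul, mul_sub, ← mul_assoc, mul_smul_comm, he0, smul_zero, zero_mul, sub_zero,
      mul_sub] at h2
    have h3 := abs_le'.1 h2
    exact sub_eq_zero.1 (le_antisymm h3.1 (neg_nonpos.1 h3.2))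
  have h1 := hφ.apply_eq_of_preconnectedSpace 0 1
  simpa [φ] using h1

/-- Moving both points by the same fraction towards the midpoint keeps their `e`-components equal
and enters the open interval; continuity does the rest. -/
theorem isLocalOn_Icc {f f' : E → E} {a b : E} (hab : LL a b)
    (hf : HasOrderModulusOn f (Set.Icc a b))
    (hdiff : ∀ x ∈ openInterval a b, HasSuperOrderDerivAt f (Set.Icc a b) x (f' x)) :
    IsLocalOn f (Set.Icc a b) := by
  intro e he x hx y hy hxy
  have hl : 0 ≤ b - a := hab.1
  set m := (1 / 2 : ℝ) • (a + b) with hmdef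
  have hm : m ∈ openInterval a b := by
    have h1 : m - a = (1 / 2 : ℝ) • (b - a) := by rw [hmdef]; module
    have h2 : b - m = (1 / 2 : ℝ) • (b - a) := by rw [hmdef]; module
    exact ⟨by rw [LL, h1]; exact hab.smul (by norm_num),
      by rw [LL, h2]; exact hab.smul (by norm_num)⟩
  have key : ∀ z ∈ Set.Icc a b, ∀ n : ℕ, z + (1 / 2 : ℝ) ^ n • (m - z) ∈ openInterval a b ∧
      |z + (1 / 2 : ℝ) ^ n • (m - z) - z| ≤ (1 / 2 : ℝ) ^ n • (b - a) := by
    intro z hz n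
    have ht1 : (1 / 2 : ℝ) ^ n ≤ 1 := pow_le_one₀ (by norm_num) (by norm_num)
    refine ⟨segment_mem_openInterval_of_Icc hz hm (by positivity) ht1, ?_⟩
    have h1 := abs_le'.1 (abs_sub_le_of_mem_Icc (openInterval_subset_Icc hm) hz)
    rw [add_sub_cancel_left]
    refine abs_le'.2 ⟨smul_le_smul_of_nonneg_left h1.1 (half_pow_nonneg n), ?_⟩
    rw [← smul_neg]
    exact smul_le_smul_of_nonneg_left h1.2 (half_pow_nonneg n)
  obtain ⟨S, hS, h1⟩ := hf x hx _ (dyadic_nonempty _) (dyadic_directed hl) (dyadic_isGLB hl)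
  obtain ⟨T, hT, h2⟩ := hf y hy _ (dyadic_nonempty _) (dyadic_directed hl) (dyadic_isGLB hl)
  have h3 : |e * (f x - f y)| ≤ 0 := by
    refine nonpos_of_le_add hS hT fun s hs t ht => ?_
    obtain ⟨_, ⟨i, rfl⟩, h1⟩ := h1 s hs
    obtain ⟨_, ⟨j, rfl⟩, h2⟩ := h2 t ht
    obtain ⟨hx1, hx2⟩ := key x hx (max i j)
    obtain ⟨hy1, hy2⟩ := key y hy (max i j)
    have h4 := h1 _ (openInterval_subset_Icc hx1)
      (hx2.trans (half_pow_smul_anti hl (le_max_left i j)))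
    have h5 := h2 _ (openInterval_subset_Icc hy1)
      (hy2.trans (half_pow_smul_anti hl (le_max_right i j)))
    have h6 := isLocalOn_openInterval hdiff e he _ hx1 _ hy1 (by
      rw [mul_add, mul_add, mul_smul_comm, mul_smul_comm, mul_sub, mul_sub, hxy])
    set x' := x + (1 / 2 : ℝ) ^ max i j • (m - x)
    set y' := y + (1 / 2 : ℝ) ^ max i j • (m - y)
    have h7 : e * (f x - f y) = e * (-(f x' - f x) + (f y' - f y)) := by
      rw [mul_add, neg_sub, mul_sub, mul_sub, mul_sub, h6]; abel
    rw [h7, ← Idem.mul_abs he]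
    refine (Idem.mul_le_self he (abs_nonneg _)).trans ((abs_add_le _ _).trans ?_)
    rw [abs_neg]
    exact add_le_add h4 h5
  have h4 := abs_le'.1 h3
  rw [mul_sub] at h4
  exact sub_eq_zero.1 (le_antisymm h4.1 (neg_nonpos.1 h4.2))

/-! ### Chords -/

/-- On `d`, the increment over length `l` takes opposite values `p` and `-p` at `u` and `u + l`.
With `e` the sign idempotent of `p`, the factor `1 - e - e` turns them into `-|p|` and `|p|`; its
square is `1`, so it can be removed after the intermediate value theorem. -/
theorem exists_half_chord {f : E → E} {a b u v d : E} (hf : HasOrderModulusOn f (Set.Icc a b))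
    (hloc : IsLocalOn f (Set.Icc a b)) (hau : a ≤ u) (huv : u ≤ v) (hvb : v ≤ b)
    (hd : IsIdempotentElem d) (hfd : d * f u = d * f v) :
    ∃ w, u ≤ w ∧ w + (1 / 2 : ℝ) • (v - u) ≤ v ∧
      d * f w = d * f (w + (1 / 2 : ℝ) • (v - u)) := by
  set l := (1 / 2 : ℝ) • (v - u) with hl
  have hl0 : 0 ≤ l := smul_nonneg (by norm_num) (sub_nonneg.2 huv)
  have hull : u + l + l = v := by rw [hl]; module
  have hD : ∀ x ∈ Set.Icc u (u + l), x ∈ Set.Icc a b ∧ x + l ∈ Set.Icc a b := by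
    intro x hx
    have h1 : x + l ≤ v := hull ▸ add_le_add_left hx.2 l
    have h2 : x ≤ x + l := le_add_of_nonneg_right hl0
    exact ⟨⟨hau.trans hx.1, h2.trans (h1.trans hvb)⟩, ⟨hau.trans (hx.1.trans h2), h1.trans hvb⟩⟩
  set p := d * (f (u + l) - f u) with hp
  have hq : d * (f (u + l + l) - f (u + l)) = -p := by
    rw [hull, hp, mul_sub, mul_sub, hfd]; abel
  obtain ⟨e, he, h1, h2, -⟩ := exists_sign p
  have h2' : p - e * p ≤ 0 := by rwa [sub_mul, one_mul] at h2
  have hsq : (1 - e - e) * (1 - e - e) = 1 := by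
    have := he.eq
    calc (1 - e - e) * (1 - e - e) = 1 - 4 • e + 4 • (e * e) := by noncomm_ring
      _ = 1 := by rw [this]; abel
  have hk : ∀ w : E, |(1 - e - e) * d * w| ≤ |w| := by
    intro w
    calc |(1 - e - e) * d * w| = |(1 - e) * (d * w) + -(e * (d * w))| := by
          congr 1; noncomm_ring
      _ ≤ |(1 - e) * (d * w)| + |-(e * (d * w))| := abs_add_le _ _
      _ = |d * w| := by
          rw [abs_neg, ← Idem.mul_abs he, ← Idem.mul_abs he.one_sub, ← add_mul, sub_add_cancel,
            one_mul]
      _ ≤ |w| := by rw [← Idem.mul_abs hd]; exact Idem.mul_le_self hd (abs_nonneg _)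
  obtain ⟨w, hw, h3⟩ := exists_zero_of_nonpos_of_nonneg
    (le_add_of_nonneg_right hl0 : u ≤ u + l) (hf.mul_sub_shift hD hk) (hloc.mul_sub_shift hD)
    (by
      rw [mul_assoc, ← hp, sub_mul, sub_mul, one_mul]
      exact sub_nonpos.2 (h2'.trans h1))
    (by
      rw [mul_assoc, hq, mul_neg, sub_mul, sub_mul, one_mul, neg_nonneg]
      exact sub_nonpos.2 (h2'.trans h1))
  refine ⟨w, hw.1, hull ▸ add_le_add_left hw.2 l, ?_⟩
  have h4 := congrArg (fun z => (1 - e - e) * z) h3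
  simp only [mul_zero] at h4
  rw [← mul_assoc, ← mul_assoc, hsq, one_mul, mul_sub, sub_eq_zero] at h4
  exact h4.symm

/-- On the component `c` there is a chord of `f` with equal end values that is nondegenerate and
bounded away from `a` and `b`. -/
def HasInnerChord (f : E → E) (a b c : E) : Prop :=
  ∃ u v, a ≤ u ∧ u ≤ v ∧ v ≤ b ∧ c * f u = c * f v ∧ ∀ d, IsIdempotentElem d →
    (d * (u - a) = 0 → d * c = 0) ∧ (d * (v - u) = 0 → d * c = 0) ∧ (d * (b - v) = 0 → d * c = 0)

/-- Inner chords on complementary parts of a component can be glued. -/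
theorem HasInnerChord.mix {f : E → E} {a b c e : E} (hloc : IsLocalOn f (Set.Icc a b))
    (he : IsIdempotentElem e) (h : HasInnerChord f a b (c * e))
    (h' : HasInnerChord f a b (c * (1 - e))) : HasInnerChord f a b c := by
  obtain ⟨u, v, hau, huv, hvb, hfuv, hd⟩ := h
  obtain ⟨u', v', hau', huv', hvb', hfuv', hd'⟩ := h'
  have he1 := he.one_sub
  have hu : u ∈ Set.Icc a b := ⟨hau, huv.trans hvb⟩
  have hv : v ∈ Set.Icc a b := ⟨hau.trans huv, hvb⟩
  have hu' : u' ∈ Set.Icc a b := ⟨hau', huv'.trans hvb'⟩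
  have hv' : v' ∈ Set.Icc a b := ⟨hau'.trans huv', hvb'⟩
  have hU := Idem.mix_mem_Icc he hu hu'
  have hV := Idem.mix_mem_Icc he hv hv'
  have hcomb : ∀ d z : E, d * z = 0 → d * e * z = 0 ∧ d * (1 - e) * z = 0 := fun d z h => by
    rw [← Idem.commute he d, ← Idem.commute he1 d, mul_assoc, mul_assoc, h, mul_zero, mul_zero]
    exact ⟨rfl, rfl⟩
  have hsplit : ∀ d : E, d * e * (c * e) = 0 →
      d * (1 - e) * (c * (1 - e)) = 0 → d * c = 0 := by
    intro d h1 h2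
    rw [← Idem.commute he c, mul_assoc, ← mul_assoc e e, he.eq] at h1
    rw [← Idem.commute he1 c, mul_assoc, ← mul_assoc (1 - e) (1 - e), he1.eq] at h2
    have h3 := congrArg₂ (· + ·) h1 h2
    simpa only [← mul_add, ← add_mul, add_sub_cancel, one_mul, add_zero] using h3
  have key : ∀ d z w w' : E, e * z = e * w →
      (1 - e) * z = (1 - e) * w' → d * z = 0 → (d * e * w = 0 → d * e * (c * e) = 0) →
      (d * (1 - e) * w' = 0 → d * (1 - e) * (c * (1 - e)) = 0) → d * c = 0 := by
    intro d z w w' h1 h2 h3 h4 h5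
    obtain ⟨h6, h7⟩ := hcomb d z h3
    refine hsplit d (h4 ?_) (h5 ?_)
    · rw [mul_assoc, ← h1, ← mul_assoc, h6]
    · rw [mul_assoc, ← h2, ← mul_assoc, h7]
  refine ⟨e * u + (1 - e) * u', e * v + (1 - e) * v', hU.1, ?_, hV.2, ?_, fun d hdi => ?_⟩
  · exact add_le_add (mul_le_mul_of_nonneg_left huv (Idem.nonneg he))
      (mul_le_mul_of_nonneg_left huv' (Idem.nonneg he1))
  · refine Idem.eq_of_split (e := e) ?_ ?_
    · have h1 := hloc e he _ hU _ hu (Idem.mul_mix he _ _)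
      have h2 := hloc e he _ hV _ hv (Idem.mul_mix he _ _)
      rw [← mul_assoc, ← mul_assoc, Idem.commute he c, mul_assoc, mul_assoc, h1, h2, ← mul_assoc,
        ← mul_assoc, hfuv]
    · have h1 := hloc _ he1 _ hU _ hu' (Idem.compl_mul_mix he _ _)
      have h2 := hloc _ he1 _ hV _ hv' (Idem.compl_mul_mix he _ _)
      rw [← mul_assoc, ← mul_assoc, Idem.commute he1 c, mul_assoc, mul_assoc, h1, h2, ← mul_assoc,
        ← mul_assoc, hfuv']
  · have i1 := Idem.mul hdi he
    have i2 := Idem.mul hdi he1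
    refine ⟨fun h => key d _ (u - a) (u' - a) ?_ ?_ h (hd _ i1).1 (hd' _ i2).1,
      fun h => key d _ (v - u) (v' - u') ?_ ?_ h (hd _ i1).2.1 (hd' _ i2).2.1,
      fun h => key d _ (b - v) (b - v') ?_ ?_ h (hd _ i1).2.2 (hd' _ i2).2.2⟩
    all_goals simp only [mul_sub, Idem.mul_mix he,
      Idem.compl_mul_mix he]

theorem exists_support_sub {x y : E} (h : x ≤ y) : ∃ e : E, IsIdempotentElem e ∧
    (1 - e) * x = (1 - e) * y ∧ ∀ d, IsIdempotentElem d → d * (y - x) = 0 → d * e = 0 := by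
  obtain ⟨e, he, h1, h2⟩ := exists_support_idem (sub_nonneg.2 h)
  refine ⟨e, he, ?_, h2⟩
  rw [← sub_eq_zero, ← mul_sub, ← neg_sub y x, mul_neg, sub_mul, one_mul, h1, sub_self, neg_zero]

theorem idem_mul_eq_zero_of_le {d l z : E} (hl : IsWeakOrderUnit l) (hd : IsIdempotentElem d)
    (h : l ≤ z) (hz : d * z = 0) : d = 0 :=
  (hl.mono h).idem_eq_zero hd hz

/-- A half chord starting at `u` is inner except where `u = a` or `u = m`, and there `f` agrees at
`a`, `m` and `b`. On that part `[a, m]` is halved again, to a chord from `w`. It is inner except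
where `w = a`, and there the other half, from `a + k` to `m`, is an inner chord. -/
theorem hasInnerChord_one {f : E → E} {a b : E} (hab : LL a b)
    (hf : HasOrderModulusOn f (Set.Icc a b)) (hloc : IsLocalOn f (Set.Icc a b))
    (hfab : f a = f b) : HasInnerChord f a b 1 := by
  have hle : a ≤ b := sub_nonneg.1 hab.1
  set l := (1 / 2 : ℝ) • (b - a) with hl
  have hlu : IsWeakOrderUnit l := IsWeakOrderUnit.smul hab (by norm_num)
  have hlu2 : IsWeakOrderUnit ((1 / 2 : ℝ) • l) := hlu.smul (by norm_num)
  set m := a + l with hm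
  have hml : m + l = b := by rw [hm, hl]; module
  have ham : a ≤ m := le_add_of_nonneg_right hlu.1
  have hmb : m ≤ b := hml ▸ le_add_of_nonneg_right hlu.1
  have haI : a ∈ Set.Icc a b := ⟨le_rfl, hle⟩
  have hbI : b ∈ Set.Icc a b := ⟨hle, le_rfl⟩
  have hmI : m ∈ Set.Icc a b := ⟨ham, hmb⟩
  obtain ⟨u, hau, hub, hfu⟩ := exists_half_chord hf hloc le_rfl hle le_rfl
    (IsIdempotentElem.one) (by rw [hfab] : 1 * f a = 1 * f b)
  rw [← hl] at hub hfu
  rw [one_mul, one_mul] at hfu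
  have hul : u ≤ u + l := le_add_of_nonneg_right hlu.1
  have hum : u ≤ m := by rw [← hml] at hub; exact le_of_add_le_add_right hub
  have huI : u ∈ Set.Icc a b := ⟨hau, hul.trans hub⟩
  have hulI : u + l ∈ Set.Icc a b := ⟨hau.trans hul, hub⟩
  obtain ⟨p, hp, hpe, hps⟩ := exists_support_sub hau
  obtain ⟨q, hq, hqe, hqs⟩ := exists_support_sub hum
  have hpq := Idem.mul hp hq
  -- off `p * q` the values at `a`, `m` and `b` agree
  have h1 : (1 - p) * f a = (1 - p) * f m := by
    rw [hloc _ hp.one_sub a haI u huI hpe, hfu]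
    exact hloc _ hp.one_sub _ hulI _ hmI (by rw [mul_add, ← hpe, ← mul_add])
  have h2 : (1 - q) * f m = (1 - q) * f a := by
    rw [hfab, ← hloc _ hq.one_sub u huI m hmI hqe, hfu]
    exact hloc _ hq.one_sub _ hulI _ hbI (by rw [mul_add, hqe, ← mul_add, hml])
  have h3 : (1 - p * q) * f a = (1 - p * q) * f m := by
    have h4 : (1 : E) - p * q = (1 - p) + p * (1 - q) := by noncomm_ring
    rw [h4, add_mul, add_mul, h1, mul_assoc, mul_assoc, h2]
  set D := 1 - p * q with hD
  have hDi : IsIdempotentElem D := hpq.one_sub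
  obtain ⟨w, haw, hwm, hfw⟩ := exists_half_chord hf hloc le_rfl ham hmb hDi h3
  have hk : m - a = l := by rw [hm]; abel
  rw [hk] at hwm hfw
  set k := (1 / 2 : ℝ) • l with hkdef
  have hkk : a + k + k = m := by rw [hm, hkdef]; module
  have hwk : w ≤ w + k := le_add_of_nonneg_right hlu2.1
  have hwI : w ∈ Set.Icc a b := ⟨haw, hwk.trans (hwm.trans hmb)⟩
  have hwkI : w + k ∈ Set.Icc a b := ⟨haw.trans hwk, hwm.trans hmb⟩
  have hak : a ≤ a + k := le_add_of_nonneg_right hlu2.1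
  have hakm : a + k ≤ m := hkk ▸ le_add_of_nonneg_right hlu2.1
  have hakI : a + k ∈ Set.Icc a b := ⟨hak, hakm.trans hmb⟩
  obtain ⟨s, hs, hse, hss⟩ := exists_support_sub haw
  have zero : ∀ {d c : E}, d = 0 → d * c = 0 := fun h => by rw [h, zero_mul]
  have hbm : b - m = l := by rw [← hml]; abel
  refine HasInnerChord.mix hloc hpq ?_ ?_
  · rw [one_mul]
    refine ⟨u, u + l, hau, hul, hub, by rw [hfu], fun d hd =>
      ⟨fun h => ?_, fun h => ?_, fun h => ?_⟩⟩
    · rw [← mul_assoc, hps d hd h, zero_mul]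
    · exact zero (idem_mul_eq_zero_of_le hlu hd le_rfl (by rwa [add_sub_cancel_left] at h))
    · rw [Idem.commute hp q, ← mul_assoc, hqs d hd, zero_mul]
      rwa [← hml, add_sub_add_right_eq_sub] at h
  · rw [one_mul]
    refine HasInnerChord.mix hloc hs ?_ ?_
    · refine ⟨w, w + k, haw, hwk, hwkI.2, ?_, fun d hd => ⟨fun h => ?_, fun h => ?_, fun h => ?_⟩⟩
      · rw [← Idem.commute hs D, mul_assoc, mul_assoc, hfw]
      · rw [← Idem.commute hs D, ← mul_assoc, hss d hd h, zero_mul]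
      · exact zero (idem_mul_eq_zero_of_le hlu2 hd le_rfl (by rwa [add_sub_cancel_left] at h))
      · exact zero (idem_mul_eq_zero_of_le hlu hd (hbm ▸ sub_le_sub_left hwm b) h)
    · refine ⟨a + k, m, hak, hakm, hmb, ?_, fun d hd => ⟨fun h => ?_, fun h => ?_, fun h => ?_⟩⟩
      · have h4 := hloc _ hs.one_sub a haI w hwI hse
        have h5 := hloc _ hs.one_sub (w + k) hwkI (a + k) hakI (by rw [mul_add, ← hse, ← mul_add])
        have hc := Idem.commute hs.one_sub D
        calc D * (1 - s) * f (a + k) = D * ((1 - s) * f (w + k)) := by rw [h5, mul_assoc]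
          _ = (1 - s) * (D * f w) := by rw [hfw, ← mul_assoc, ← hc, mul_assoc]
          _ = D * ((1 - s) * f a) := by rw [h4, ← mul_assoc, hc, mul_assoc]
          _ = (1 - s) * (D * f a) := by rw [← mul_assoc, ← hc, mul_assoc]
          _ = D * (1 - s) * f m := by rw [h3, ← mul_assoc, hc]
      · exact zero (idem_mul_eq_zero_of_le hlu2 hd le_rfl (by rwa [add_sub_cancel_left] at h))
      · exact zero (idem_mul_eq_zero_of_le hlu2 hd (by rw [← hkk, add_sub_cancel_left]) h)
      · exact zero (idem_mul_eq_zero_of_le hlu hd hbm.ge h)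

theorem exists_inner_chord {f : E → E} {a b : E} (hab : LL a b)
    (hf : HasOrderModulusOn f (Set.Icc a b)) (hloc : IsLocalOn f (Set.Icc a b))
    (hfab : f a = f b) : ∃ u v, LL a u ∧ LL u v ∧ LL v b ∧ f u = f v := by
  obtain ⟨u, v, hau, huv, hvb, hfuv, hd⟩ := hasInnerChord_one hab hf hloc hfab
  simp only [mul_one] at hd
  rw [one_mul, one_mul] at hfuv
  exact ⟨u, v, isWeakOrderUnit_of_idem (sub_nonneg.2 hau) fun d h => (hd d h).1,
    isWeakOrderUnit_of_idem (sub_nonneg.2 huv) fun d h => (hd d h).2.1,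
    isWeakOrderUnit_of_idem (sub_nonneg.2 hvb) fun d h => (hd d h).2.2, hfuv⟩

theorem exists_nested_chords {f : E → E} {a b u v : E} (hf : HasOrderModulusOn f (Set.Icc a b))
    (hloc : IsLocalOn f (Set.Icc a b)) (hau : a ≤ u) (huv : u ≤ v) (hvb : v ≤ b)
    (hfuv : f u = f v) : ∃ w : ℕ → E, w 0 = u ∧ Monotone w ∧
      Antitone (fun n => w n + (1 / 2 : ℝ) ^ n • (v - u)) ∧
      ∀ n, f (w n) = f (w n + (1 / 2 : ℝ) ^ n • (v - u)) := by
  have hl : 0 ≤ v - u := sub_nonneg.2 huv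
  -- The invariant is a premise inside the existential, so that `choose` yields a total function to
  -- iterate.
  have step : ∀ (n : ℕ) (x : E), ∃ y : E,
      (u ≤ x ∧ x + (1 / 2 : ℝ) ^ n • (v - u) ≤ v ∧ f x = f (x + (1 / 2 : ℝ) ^ n • (v - u))) →
      x ≤ y ∧ y + (1 / 2 : ℝ) ^ (n + 1) • (v - u) ≤ x + (1 / 2 : ℝ) ^ n • (v - u) ∧
        f y = f (y + (1 / 2 : ℝ) ^ (n + 1) • (v - u)) := by
    intro n x
    by_cases h : u ≤ x ∧ x + (1 / 2 : ℝ) ^ n • (v - u) ≤ v ∧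
      f x = f (x + (1 / 2 : ℝ) ^ n • (v - u))
    · obtain ⟨y, h1, h2, h3⟩ := exists_half_chord hf hloc (hau.trans h.1)
        (le_add_of_nonneg_right (smul_nonneg (half_pow_nonneg n) hl)) (h.2.1.trans hvb)
        IsIdempotentElem.one (by rw [h.2.2] : (1 : E) * f x = 1 * f _)
      rw [add_sub_cancel_left, smul_smul, ← pow_succ'] at h2 h3
      rw [one_mul, one_mul] at h3
      exact ⟨y, fun _ => ⟨h1, h2, h3⟩⟩
    · exact ⟨x, fun h' => absurd h' h⟩
  choose F hF using step
  let w : ℕ → E := fun n => Nat.rec u F n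
  have hw : ∀ n, w (n + 1) = F n (w n) := fun _ => rfl
  have inv : ∀ n, u ≤ w n ∧ w n + (1 / 2 : ℝ) ^ n • (v - u) ≤ v ∧
      f (w n) = f (w n + (1 / 2 : ℝ) ^ n • (v - u)) := by
    intro n
    induction n with
    | zero => exact ⟨le_rfl, by simp [w], by simpa [w] using hfuv⟩
    | succ n ih =>
      obtain ⟨h1, h2, h3⟩ := hF n (w n) ih
      rw [hw]
      exact ⟨ih.1.trans h1, h2.trans ih.2.1, h3⟩
  exact ⟨w, rfl, monotone_nat_of_le_succ fun n => (hF n (w n) (inv n)).1,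
    antitone_nat_of_succ_le fun n => (hF n (w n) (inv n)).2.1, fun n => (inv n).2.2⟩

/-- If `f` takes equal values at the ends of arbitrarily short chords around a point, then its
derivative at that point vanishes. -/
theorem HasSuperOrderDerivAt.eq_zero {f : E → E} {D : Set E} {c d l : E}
    (hd : HasSuperOrderDerivAt f D c d) (hl : IsWeakOrderUnit l)
    (h : ∀ n : ℕ, ∃ x ∈ D, x + (1 / 2 : ℝ) ^ n • l ∈ D ∧ x ≤ c ∧ c ≤ x + (1 / 2 : ℝ) ^ n • l ∧
      f x = f (x + (1 / 2 : ℝ) ^ n • l)) : d = 0 := by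
  obtain ⟨-, r, -, -, hd⟩ := hd
  obtain ⟨S, hS, hd⟩ := hd _ (dyadic_nonempty _) (dyadic_directed hl.1) (dyadic_isGLB hl.1)
  have key : ∀ ε ∈ S, d ≤ ε ∧ -d ≤ ε := by
    intro ε hε
    obtain ⟨_, ⟨n, rfl⟩, hd⟩ := hd ε hε
    obtain ⟨x, hx, hy, hxc, hcy, hfxy⟩ := h n
    have hlu := hl.smul (by positivity : (0 : ℝ) < (1 / 2) ^ n)
    beta_reduce at hd
    generalize (1 / 2 : ℝ) ^ n • l = t at *
    have h1 := hd x hx (by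
      rw [abs_sub_comm, abs_of_nonneg (sub_nonneg.2 hxc)]; exact sub_le_iff_le_add'.2 hcy)
    have h2 := hd (x + t) hy (by
      rw [abs_of_nonneg (sub_nonneg.2 hcy), add_sub_right_comm]
      exact add_le_of_nonpos_left (sub_nonpos.2 hxc))
    rw [abs_sub_comm x c, abs_of_nonneg (sub_nonneg.2 hxc)] at h1
    rw [abs_of_nonneg (sub_nonneg.2 hcy)] at h2
    -- Since `c` lies between the chord's ends, its distances to them add up to exactly `t`; the
    -- weak order unit `t` then cancels.
    have h3 : |t * d| ≤ t * ε := by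
      calc |t * d| = |(f x - f c - (x - c) * d) + -(f (x + t) - f c - (x + t - c) * d)| := by
            congr 1; rw [hfxy]; noncomm_ring
        _ ≤ |f x - f c - (x - c) * d| + |-(f (x + t) - f c - (x + t - c) * d)| := abs_add_le _ _
        _ ≤ (c - x) * ε + (x + t - c) * ε := by rw [abs_neg]; exact add_le_add h1 h2
        _ = t * ε := by rw [← add_mul]; congr 1; abel
    have h4 := abs_le'.1 h3
    refine ⟨sub_nonpos.1 (hlu.nonpos_of_mul_nonpos ?_), sub_nonpos.1 (hlu.nonpos_of_mul_nonpos ?_)⟩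
    · rw [mul_sub]; exact sub_nonpos.2 h4.1
    · rw [mul_sub, mul_neg]; exact sub_nonpos.2 h4.2
  exact le_antisymm (hS.2 fun ε hε => (key ε hε).1)
    (neg_nonpos.1 (hS.2 fun ε hε => (key ε hε).2))

end Rolle

end PhiAlg

theorem mainTheorem6 {E : Type*} [Ring E] [ConditionallyCompleteLattice E] [Algebra ℝ E]
    [PhiAlg.IsPhiAlgebra E] (a b : E) (hab : PhiAlg.LL a b) (f f' : E → E)
    (hcont : PhiAlg.OrderContinuousOn f (Set.Icc a b))
    (hdiff : ∀ x ∈ PhiAlg.openInterval a b,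
      PhiAlg.HasSuperOrderDerivAt f (Set.Icc a b) x (f' x))
    (hfab : f a = f b) :
    ∃ x₀ ∈ PhiAlg.openInterval a b, f' x₀ = 0 := by
  have hf := hcont.hasOrderModulusOn
  have hloc := PhiAlg.isLocalOn_Icc hab hf hdiff
  obtain ⟨u, v, hau, huv, hvb, hfuv⟩ := PhiAlg.exists_inner_chord hab hf hloc hfab
  have hau' := sub_nonneg.1 hau.1
  have hvb' := sub_nonneg.1 hvb.1
  obtain ⟨w, hw0, hw, hw', hfw⟩ := PhiAlg.exists_nested_chords hf hloc hau'
    (sub_nonneg.1 huv.1) hvb' hfuv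
  -- Every left end lies below every right end, so the supremum of the left ends belongs to all the
  -- chords.
  have hcross : ∀ i j, w i ≤ w j + (1 / 2 : ℝ) ^ j • (v - u) := fun i j =>
    (hw (le_max_left i j)).trans ((le_add_of_nonneg_right
      (smul_nonneg (PhiAlg.half_pow_nonneg _) huv.1)).trans (hw' (le_max_right i j)))
  have hlub := isLUB_csSup (Set.range_nonempty w) ⟨_, by rintro _ ⟨i, rfl⟩; exact hcross i 0⟩
  set c := sSup (Set.range w)
  have hwc : ∀ n, w n ≤ c := fun n => hlub.1 ⟨n, rfl⟩
  have hcw : ∀ n, c ≤ w n + (1 / 2 : ℝ) ^ n • (v - u) := fun n =>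
    hlub.2 (by rintro _ ⟨i, rfl⟩; exact hcross i n)
  have huc : u ≤ c := hw0 ▸ hwc 0
  have h0 : w 0 + (1 / 2 : ℝ) ^ 0 • (v - u) = v := by rw [hw0, pow_zero, one_smul]; abel
  have hcv : c ≤ v := h0 ▸ hcw 0
  have hc : c ∈ PhiAlg.openInterval a b :=
    ⟨PhiAlg.IsWeakOrderUnit.mono hau (sub_le_sub_right huc a),
    PhiAlg.IsWeakOrderUnit.mono hvb (sub_le_sub_left hcv b)⟩
  have huw : ∀ n, u ≤ w n := fun n => hw0 ▸ hw (Nat.zero_le n)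
  have hwv : ∀ n, w n + (1 / 2 : ℝ) ^ n • (v - u) ≤ v := fun n =>
    (hw' (Nat.zero_le n)).trans h0.le
  refine ⟨c, hc, (hdiff c hc).eq_zero huv fun n => ⟨w n, ⟨hau'.trans (huw n), ?_⟩,
    ⟨hau'.trans (huc.trans (hcw n)), (hwv n).trans hvb'⟩, hwc n, hcw n, hfw n⟩⟩
  exact (hwc n).trans (hcv.trans hvb')
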